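/- **Theorem.** *Burning.* A graph $G$ is burned in rounds. Initially no vertex is burned. In each round $t\ge1$ one vertex that is still unburned at the end of round $t-1$ is chosen and becomes burned, and at the same time every neighbour of a vertex that was burned by the end of round $t-1$ becomes burned; burned vertices stay burned. The burning number $b(G)$ is the least $k$ such that all vertices of $G$ can be burned in at most $k$ rounds. *The graphs.* For integers $g\ge3$ and $a_1\ge a_2\ge1$, let $U_g^{a_1,a_2}$ be the graph of order $n=g+a_1+a_2$ obtained from a cycle $C_g$ by attaching two pendant paths, with $a_1$ and $a_2$ new vertices, at one and the same vertex of the cycle. *The exceptional families.* For integers $q,r$ define the following sets of triples $(g,a_1,a_2)$, where $n=g+a_1+a_2$: $\mathcal B=\{(2q-2,q^2-q-2,q+1),\ (2q-1,q^2-q-2,q+1)\}$; $B_1=\{(q^2-2,q,q),\ (q^2-6,q+2,q+2),\ (q^2-10,q+4,q+4),\ (q^2-3,q+1,q),\ (q^2-5,q+3,q),\ (q^2-7,q+3,q+2),\ (q^2-8,q+3,q+3),\ (q^2-7,q+5,q),\ (q^2-10,q+5,q+3),\ (q^2-11,q+5,q+4),\ (q^2-12,q+5,q+5),\ (q^2-14,q+6,q+6),\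 (q^2-12,q+7,q+3),\ (q^2-14,q+7,q+5),\ (q^2-14,q+9,q+3)\}$; $B_2=\{(2q,q^2-q-2,q),\ (2q+2,q^2-q-6,q+2),\ (2q+4,q^2-q-10,q+4),\ (2q+1,q^2-q-3,q),\ (2q+3,q^2-q-5,q),\ (2q+3,q^2-q-7,q+2),\ (2q+3,q^2-q-8,q+3),\ (2q+5,q^2-q-7,q),\ (2q+5,q^2-q-10,q+3),\ (2q+5,q^2-q-11,q+4),\ (2q+5,q^2-q-12,q+5),\ (2q+6,q^2-q-14,q+6),\ (2q+7,q^2-q-12,q+3),\ (2q+7,q^2-q-14,q+5),\ (2q+9,q^2-q-14,q+3)\}$; $B_3=\{(2q,q^2-q-3,q+1),\ (2q,q^2-q-5,q+3),\ (2q+2,q^2-q-7,q+3),\ (2q,q^2-q-7,q+5),\ (2q+3,q^2-q-10,q+5),\ (2q+4,q^2-q-11,q+5),\ (2q+3,q^2-q-12,q+7),\ (2q+5,q^2-q-14,q+7),\ (2q+3,q^2-q-14,q+9)\}$; $B_4=\{(24,16,6),\ (22,16,8),\ (35,19,7),\ (32,19,10),\ (30,19,12),\ (28,19,14),\ (26,19,16),\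 (30,21,10),\ (28,21,12),\ (45,22,11),\ (43,22,13),\ (41,22,15),\ (34,22,22),\ (43,24,11),\ (41,24,13),\ (32,24,22),\ (41,26,11),\ (60,25,12),\ (58,25,14),\ (47,25,25),\ (58,27,12),\ (47,38,12),\ (77,28,13)\}$; $B_5=\{(22,18,6),\ (22,16,8),\ (26,28,7),\ (26,25,10),\ (26,23,12),\ (26,21,14),\ (26,19,16),\ (28,23,10),\ (28,21,12),\ (30,37,11),\ (30,35,13),\ (30,33,15),\ (30,26,22),\ (32,35,11),\ (32,33,13),\ (32,24,22),\ (34,33,11),\ (34,51,12),\ (34,49,14),\ (34,38,25),\ (36,49,12),\ (47,38,12),\ (38,67,13)\}$; $B_6=\{(12,18,16),\ (14,16,16),\ (14,28,19),\ (17,25,19),\ (19,23,19),\ (21,21,19),\ (23,19,19),\ (17,23,21),\ (19,21,21),\ (19,37,22),\ (21,35,22),\ (23,33,22),\ (30,26,22),\ (19,35,24),\ (21,33,24),\ (30,24,24),\ (19,33,26),\ (21,51,25),\ (23,49,25),\ (34,38,25),\ (21,49,27),\ (21,38,38),\ (23,67,28)\}$; $\mathcal C_1=\{(2q+1,q^2-q-2,r-q+1),\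 (q^2-2,q+1,r-q+1)\}$; $\mathcal C_2=\{(q^2-7,q+2,q+1),\ (2q+1,q^2-q-6,q+1),\ (2q+1,q^2-q-7,q+2)\}$; $\mathcal C_3=\{(q^2-3,q,q),\ (q^2-5,q+1,q+1),\ (q^2-6,q+2,q+1),\ (q^2-7,q+2,q+2),\ (q^2-7,q+3,q+1),\ (q^2-11,q+4,q+4),\ (2q+4,q^2-q-11,q+4),\ (2q+1,q^2-q-5,q+1),\ (2q+1,q^2-q-6,q+2),\ (2q+1,q^2-q-7,q+3),\ (2q+2,q^2-q-6,q+1),\ (2q+2,q^2-q-7,q+2),\ (2q+3,q^2-q-7,q+1),\ (2q,q^2-q-3,q),\ (22,16,7),\ (13,16,16)\}$; $\mathcal C_4=\{(g,a_1,a_2): n=q^2+2q-2,\ g-q\ge a_1\ge a_2=q+1\}\cup B_1\cup B_4$; $\mathcal C_5=\{(g,a_1,a_2): n=q^2+2q-2,\ a_1\ge g-q\ge a_2=q+1\}\cup B_2\cup B_5$; $\mathcal C_6=\{(g,a_1,a_2): n=q^2+2q-2,\ a_1\ge a_2\ge g-q=q+1\}\cup B_3\cup B_6$. *Statement.* Let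 $g\ge3$, $a_1\ge a_2\ge1$ and suppose that $n=g+a_1+a_2=q^2+r$ with $1\le r\le 2q-2$. Assume that one of the following holds: 1. $r+1\le g\le 2q-1$, $a_1\le q^2-\lfloor g/2\rfloor-1$ and $(g,a_1,a_2)\notin\mathcal B$; 2. $2q\le g\le q^2$, $a_2\ge r-q+1$ and $(g,a_1,a_2)\notin\bigcup_{i=1}^6\mathcal C_i$. Then $b(U_g^{a_1,a_2})=\lceil\sqrt n\,\rceil-1=q$. -/

import Mathlib

/-- `BurnsTo G t B`: some run of the burning process on `G` has burned exactly the vertices in `B`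
at the end of round `t`.  In each round one vertex `x` that is still unburned is set on fire, while
the fire spreads from every vertex burned earlier to all of its neighbours. -/
inductive BurnsTo {V : Type*} (G : SimpleGraph V) : ℕ → Set V → Prop
  | start : BurnsTo G 0 ∅
  | round {t : ℕ} {B : Set V} (h : BurnsTo G t B) (x : V) (hx : x ∉ B) :
      BurnsTo G (t + 1) (B ∪ {v | ∃ u ∈ B, G.Adj u v} ∪ {x})

/-- `G` can be burned completely in at most `k` rounds. -/
def IsBurnable {V : Type*} (G : SimpleGraph V) (k : ℕ) : Prop :=
  ∃ t ≤ k, BurnsTo G t Set.univ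

/-- The least `k` such that `G` is `k`-burnable. -/
noncomputable def burningNumber {V : Type*} (G : SimpleGraph V) : ℕ :=
  sInf {k | IsBurnable G k}

/-- The graph obtained from the cycle `C_g` (vertices `Sum.inl i`) by attaching at one of its
vertices, `Sum.inl 0`, two paths with `a₁` and `a₂` new vertices.  The new vertex at
distance `j + 1` from the cycle is `Sum.inr (Sum.inl j)`, respectively `Sum.inr (Sum.inr j)`. -/
def unicyclicGraph (g a₁ a₂ : ℕ) : SimpleGraph (Fin g ⊕ Fin a₁ ⊕ Fin a₂) :=
  SimpleGraph.fromRel fun x y =>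
    match x, y with
    | .inl i, .inl j => (SimpleGraph.cycleGraph g).Adj i j
    | .inl i, .inr (.inl j) => i.val = 0 ∧ j.val = 0
    | .inl i, .inr (.inr j) => i.val = 0 ∧ j.val = 0
    | .inr (.inl i), .inr (.inl j) => (SimpleGraph.pathGraph a₁).Adj i j
    | .inr (.inr i), .inr (.inr j) => (SimpleGraph.pathGraph a₂).Adj i j
    | _, _ => False

/-! The exceptional sets of triples `(g, a₁, a₂)`. -/

def exceptB (q : ℤ) : Set (ℤ × ℤ × ℤ) :=
  {(2 * q - 2, q ^ 2 - q - 2, q + 1), (2 * q - 1, q ^ 2 - q - 2, q + 1)}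

def exceptB1 (q : ℤ) : Set (ℤ × ℤ × ℤ) :=
  {(q ^ 2 - 2, q, q), (q ^ 2 - 6, q + 2, q + 2), (q ^ 2 - 10, q + 4, q + 4),
   (q ^ 2 - 3, q + 1, q), (q ^ 2 - 5, q + 3, q), (q ^ 2 - 7, q + 3, q + 2),
   (q ^ 2 - 8, q + 3, q + 3), (q ^ 2 - 7, q + 5, q), (q ^ 2 - 10, q + 5, q + 3),
   (q ^ 2 - 11, q + 5, q + 4), (q ^ 2 - 12, q + 5, q + 5), (q ^ 2 - 14, q + 6, q + 6),
   (q ^ 2 - 12, q + 7, q + 3), (q ^ 2 - 14, q + 7, q + 5), (q ^ 2 - 14, q + 9, q + 3)}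

def exceptB2 (q : ℤ) : Set (ℤ × ℤ × ℤ) :=
  {(2 * q, q ^ 2 - q - 2, q), (2 * q + 2, q ^ 2 - q - 6, q + 2),
   (2 * q + 4, q ^ 2 - q - 10, q + 4), (2 * q + 1, q ^ 2 - q - 3, q),
   (2 * q + 3, q ^ 2 - q - 5, q), (2 * q + 3, q ^ 2 - q - 7, q + 2),
   (2 * q + 3, q ^ 2 - q - 8, q + 3), (2 * q + 5, q ^ 2 - q - 7, q),
   (2 * q + 5, q ^ 2 - q - 10, q + 3), (2 * q + 5, q ^ 2 - q - 11, q + 4),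
   (2 * q + 5, q ^ 2 - q - 12, q + 5), (2 * q + 6, q ^ 2 - q - 14, q + 6),
   (2 * q + 7, q ^ 2 - q - 12, q + 3), (2 * q + 7, q ^ 2 - q - 14, q + 5),
   (2 * q + 9, q ^ 2 - q - 14, q + 3)}

def exceptB3 (q : ℤ) : Set (ℤ × ℤ × ℤ) :=
  {(2 * q, q ^ 2 - q - 3, q + 1), (2 * q, q ^ 2 - q - 5, q + 3),
   (2 * q + 2, q ^ 2 - q - 7, q + 3), (2 * q, q ^ 2 - q - 7, q + 5),
   (2 * q + 3, q ^ 2 - q - 10, q + 5), (2 * q + 4, q ^ 2 - q - 11, q + 5),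
   (2 * q + 3, q ^ 2 - q - 12, q + 7), (2 * q + 5, q ^ 2 - q - 14, q + 7),
   (2 * q + 3, q ^ 2 - q - 14, q + 9)}

def exceptB4 : Set (ℤ × ℤ × ℤ) :=
  {(24, 16, 6), (22, 16, 8), (35, 19, 7), (32, 19, 10), (30, 19, 12), (28, 19, 14), (26, 19, 16),
   (30, 21, 10), (28, 21, 12), (45, 22, 11), (43, 22, 13), (41, 22, 15), (34, 22, 22),
   (43, 24, 11), (41, 24, 13), (32, 24, 22), (41, 26, 11), (60, 25, 12), (58, 25, 14),
   (47, 25, 25), (58, 27, 12), (47, 38, 12), (77, 28, 13)}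

def exceptB5 : Set (ℤ × ℤ × ℤ) :=
  {(22, 18, 6), (22, 16, 8), (26, 28, 7), (26, 25, 10), (26, 23, 12), (26, 21, 14), (26, 19, 16),
   (28, 23, 10), (28, 21, 12), (30, 37, 11), (30, 35, 13), (30, 33, 15), (30, 26, 22),
   (32, 35, 11), (32, 33, 13), (32, 24, 22), (34, 33, 11), (34, 51, 12), (34, 49, 14),
   (34, 38, 25), (36, 49, 12), (47, 38, 12), (38, 67, 13)}

def exceptB6 : Set (ℤ × ℤ × ℤ) :=
  {(12, 18, 16), (14, 16, 16), (14, 28, 19), (17, 25, 19), (19, 23, 19), (21, 21, 19),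
   (23, 19, 19), (17, 23, 21), (19, 21, 21), (19, 37, 22), (21, 35, 22), (23, 33, 22),
   (30, 26, 22), (19, 35, 24), (21, 33, 24), (30, 24, 24), (19, 33, 26), (21, 51, 25),
   (23, 49, 25), (34, 38, 25), (21, 49, 27), (21, 38, 38), (23, 67, 28)}

def exceptC1 (q r : ℤ) : Set (ℤ × ℤ × ℤ) :=
  {(2 * q + 1, q ^ 2 - q - 2, r - q + 1), (q ^ 2 - 2, q + 1, r - q + 1)}

def exceptC2 (q : ℤ) : Set (ℤ × ℤ × ℤ) :=
  {(q ^ 2 - 7, q + 2, q + 1), (2 * q + 1, q ^ 2 - q - 6, q + 1),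
   (2 * q + 1, q ^ 2 - q - 7, q + 2)}

def exceptC3 (q : ℤ) : Set (ℤ × ℤ × ℤ) :=
  {(q ^ 2 - 3, q, q), (q ^ 2 - 5, q + 1, q + 1), (q ^ 2 - 6, q + 2, q + 1),
   (q ^ 2 - 7, q + 2, q + 2), (q ^ 2 - 7, q + 3, q + 1), (q ^ 2 - 11, q + 4, q + 4),
   (2 * q + 4, q ^ 2 - q - 11, q + 4), (2 * q + 1, q ^ 2 - q - 5, q + 1),
   (2 * q + 1, q ^ 2 - q - 6, q + 2), (2 * q + 1, q ^ 2 - q - 7, q + 3),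
   (2 * q + 2, q ^ 2 - q - 6, q + 1), (2 * q + 2, q ^ 2 - q - 7, q + 2),
   (2 * q + 3, q ^ 2 - q - 7, q + 1), (2 * q, q ^ 2 - q - 3, q), (22, 16, 7), (13, 16, 16)}

def exceptC4 (q : ℤ) : Set (ℤ × ℤ × ℤ) :=
  {(g, a₁, a₂) : ℤ × ℤ × ℤ | g + a₁ + a₂ = q ^ 2 + 2 * q - 2 ∧
    g - q ≥ a₁ ∧ a₁ ≥ a₂ ∧ a₂ = q + 1} ∪ exceptB1 q ∪ exceptB4

def exceptC5 (q : ℤ) : Set (ℤ × ℤ × ℤ) :=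
  {(g, a₁, a₂) : ℤ × ℤ × ℤ | g + a₁ + a₂ = q ^ 2 + 2 * q - 2 ∧
    a₁ ≥ g - q ∧ g - q ≥ a₂ ∧ a₂ = q + 1} ∪ exceptB2 q ∪ exceptB5

def exceptC6 (q : ℤ) : Set (ℤ × ℤ × ℤ) :=
  {(g, a₁, a₂) : ℤ × ℤ × ℤ | g + a₁ + a₂ = q ^ 2 + 2 * q - 2 ∧
    a₁ ≥ a₂ ∧ a₂ ≥ g - q ∧ g - q = q + 1} ∪ exceptB3 q ∪ exceptB6

def exceptC (q r : ℤ) : Set (ℤ × ℤ × ℤ) :=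
  exceptC1 q r ∪ exceptC2 q ∪ exceptC3 q ∪ exceptC4 q ∪ exceptC5 q ∪ exceptC6 q

/-!
The hub of the graph has degree four and every other vertex has degree at most two, so the number
of vertices bordering the burned set grows by two per round, plus two once after the hub has
burned. Hence fewer than `(k + 1) ^ 2` vertices burn in `k` rounds, and `b(G) ≥ q`.

Conversely, write `q = m + 1` and centre a ball of radius `m`, the fire lit in the first round, at
the hub. It leaves three disjoint paths, and the other fires can be aimed at subpaths with
`1, 3, …, 2 * m - 1` vertices. The triples of path lengths that such subpaths cannot cover are
classified by induction on `m`, placing the longest subpath on the longest path; the cases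
`m < 11` are a finite search. Read off the lengths `g - (2 * m + 1)`, `a₁ - m`, `a₂ - m`, the
classification yields the exceptional families, except for a few triples that become coverable when
the ball is centred one step along the first pendant path. For a cycle with fewer than `2 * q`
vertices the ball at the hub covers the cycle, and if it also covers the second path it is shifted
along the first one.
-/

section Tilings

/-- Disjoint paths with `x j` vertices, `j : ι`, can be covered by subpaths with
`1, 3, …, 2 * m - 1` vertices, the one with `2 * i + 1` vertices being placed on the path `σ i`. -/
def Coverable {ι : Type*} [DecidableEq ι] (m : ℕ) (x : ι → ℕ) : Prop :=
  ∃ σ : ℕ → ι, ∀ j, x j ≤ ∑ i ∈ Finset.range m with σ i = j, (2 * i + 1)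

namespace Coverable

variable {ι : Type*} [DecidableEq ι] {m : ℕ} {x y : ι → ℕ}

theorem mono (h : Coverable m y) (hxy : x ≤ y) : Coverable m x :=
  h.imp fun _ hσ j => (hxy j).trans (hσ j)

theorem of_comp_perm (e : Equiv.Perm ι) (h : Coverable m (x ∘ e)) : Coverable m x := by
  obtain ⟨σ, hσ⟩ := h
  refine ⟨e ∘ σ, fun j => ?_⟩
  simpa [Equiv.eq_symm_apply] using hσ (e.symm j)

theorem succ_iff : Coverable (m + 1) x ↔
    ∃ i, Coverable m (Function.update x i (x i - (2 * m + 1))) := by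
  constructor
  · rintro ⟨σ, hσ⟩
    refine ⟨σ m, σ, fun j => ?_⟩
    have := hσ j
    rw [Finset.range_add_one, Finset.filter_insert] at this
    obtain rfl | hj := eq_or_ne (σ m) j
    · rw [if_pos rfl, Finset.sum_insert (by simp)] at this
      rw [Function.update_self]
      omega
    · rwa [if_neg hj, ← Function.update_of_ne hj.symm (x (σ m) - (2 * m + 1)) x] at this
  · rintro ⟨i, σ, hσ⟩
    refine ⟨Function.update σ m i, fun j => ?_⟩
    have hlt : {k ∈ Finset.range m | Function.update σ m i k = j} =
        {k ∈ Finset.range m | σ k = j} :=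
      Finset.filter_congr fun k hk => by
        rw [Function.update_of_ne (Finset.mem_range.1 hk).ne]
    have := hσ j
    rw [Finset.range_add_one, Finset.filter_insert, Function.update_self, hlt]
    obtain rfl | hj := eq_or_ne i j
    · rw [if_pos rfl, Finset.sum_insert (by simp)]
      rw [Function.update_self] at this
      omega
    · rwa [if_neg hj, ← Function.update_of_ne hj.symm (x i - (2 * m + 1)) x]

theorem swap_left {a b c : ℕ} (h : Coverable m ![b, a, c]) : Coverable m ![a, b, c] :=
  of_comp_perm (Equiv.swap 0 1) <| by
    convert h
    ext i; fin_cases i <;> rfl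

theorem swap_right {a b c : ℕ} (h : Coverable m ![a, c, b]) : Coverable m ![a, b, c] :=
  of_comp_perm (Equiv.swap 1 2) <| by
    convert h
    ext i; fin_cases i <;> rfl

theorem mono_left {a a' b c : ℕ} (h : Coverable m ![a', b, c]) (ha : a ≤ a') :
    Coverable m ![a, b, c] :=
  h.mono <| by simp [Pi.le_def, Fin.forall_fin_succ, ha]

theorem succ_left {a b c : ℕ} (h : Coverable m ![a - (2 * m + 1), b, c]) :
    Coverable (m + 1) ![a, b, c] :=
  succ_iff.2 ⟨0, by
    convert h
    ext i; fin_cases i <;> rfl⟩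

end Coverable

/-- Backtracking search for a cover in the sense of `Coverable` of three paths, which places the
longest subpath first and prunes by counting vertices. -/
def coverSearch : ℕ → ℕ → ℕ → ℕ → Bool
  | 0, x, y, z => Nat.beq (x + y + z) 0
  | m + 1, x, y, z => Nat.ble (x + y + z) ((m + 1) * (m + 1)) &&
      (coverSearch m (x - (2 * m + 1)) y z || coverSearch m x (y - (2 * m + 1)) z ||
        coverSearch m x y (z - (2 * m + 1)))

theorem Coverable.of_coverSearch {m x y z : ℕ} (h : coverSearch m x y z = true) :
    Coverable m ![x, y, z] := by
  induction m generalizing x y z with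
  | zero =>
    have := Nat.eq_of_beq_eq_true h
    exact ⟨0, by simp [Fin.forall_fin_succ]; omega⟩
  | succ m ih =>
    simp only [coverSearch, Bool.and_eq_true, Bool.or_eq_true] at h
    obtain ⟨-, (h | h) | h⟩ := h
    · exact (ih h).succ_left
    · exact (ih h).swap_left.succ_left.swap_left
    · exact (ih h).swap_right.swap_left.succ_left.swap_left.swap_right

/-- The triples `(s, y, z)` for which, as soon as `m` is large enough, three paths with `x ≥ y ≥ z`
vertices and `x + y + z + s = m ^ 2` are not coverable in the sense of `Coverable`; the case of a
path with two vertices and `s = 0` is not included. -/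
def shortPathExceptions : List (ℕ × ℕ × ℕ) :=
  [(0, 1, 1), (0, 3, 3), (0, 5, 5), (0, 4, 1), (0, 4, 3), (0, 4, 4), (0, 6, 1), (0, 6, 4),
    (0, 6, 5), (0, 6, 6), (0, 7, 7), (0, 8, 4), (0, 8, 6), (0, 10, 4), (1, 1, 1), (1, 2, 2),
    (1, 3, 2), (1, 3, 3), (1, 4, 2), (1, 5, 5), (2, 2, 2), (2, 3, 2), (3, 2, 2)]

/-- The tuples `(m, x, y, z)`, `x ≥ y ≥ z`, outside the families given by `shortPathExceptions` and
by paths with two vertices, such that paths with `x`, `y` and `z` vertices are not coverable by `m`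
subpaths in the sense of `Coverable`. -/
def sporadicExceptions : List (ℕ × ℕ × ℕ × ℕ) :=
  [(5, 11, 11, 2), (5, 11, 11, 3), (5, 13, 11, 1), (6, 13, 13, 10), (6, 15, 13, 8), (6, 15, 15, 6),
    (6, 17, 13, 6), (6, 17, 15, 4), (6, 19, 13, 4), (6, 22, 13, 1), (7, 17, 17, 15),
    (7, 19, 15, 15), (7, 26, 15, 8), (7, 26, 17, 6), (7, 26, 19, 4), (7, 28, 15, 6), (7, 28, 17, 4),
    (7, 30, 15, 4), (8, 30, 17, 17), (8, 30, 30, 4), (8, 41, 17, 6), (8, 41, 19, 4), (8, 43, 17, 4),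
    (9, 58, 19, 4)]

/-- The triples of lengths `x ≥ y ≥ z` with `x + y + z ≤ m ^ 2` excluded in the classification of
the triples that are coverable by `m` subpaths in the sense of `Coverable`. -/
def Exceptional (m x y z : ℕ) : Prop :=
  (x + y + z = m ^ 2 ∧ (y = 2 ∨ z = 2)) ∨
    (∃ s, x + y + z + s = m ^ 2 ∧ (s, y, z) ∈ shortPathExceptions) ∨
    (m, x, y, z) ∈ sporadicExceptions

theorem bounds_of_mem_shortPathExceptions {s y z : ℕ} (h : (s, y, z) ∈ shortPathExceptions) :
    s ≤ 3 ∧ y ≤ 10 ∧ z ≤ y ∧ 1 ≤ z :=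
  (by decide : ∀ p ∈ shortPathExceptions, p.1 ≤ 3 ∧ p.2.1 ≤ 10 ∧ p.2.2 ≤ p.2.1 ∧ 1 ≤ p.2.2) _ h

theorem bounds_of_mem_sporadicExceptions {m x y z : ℕ} (h : (m, x, y, z) ∈ sporadicExceptions) :
    m ≤ 9 ∧ 1 ≤ z ∧ m ^ 2 ≤ x + y + z + 1 :=
  (by decide : ∀ p ∈ sporadicExceptions,
    p.1 ≤ 9 ∧ 1 ≤ p.2.2.2 ∧ p.1 ^ 2 ≤ p.2.1 + p.2.2.1 + p.2.2.2 + 1) _ h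

/-- Decidable form of the classification for the paths with `m ^ 2 - s - y - z`, `y` and `z`
vertices; the first alternative says that the second path is longer than the first one. -/
def SearchOrExceptional (m s y z : ℕ) : Prop :=
  m * m < y + y + z + s ∨ coverSearch m (m * m - s - y - z) y z = true ∨
    (s = 0 ∧ (y = 2 ∨ z = 2)) ∨ (s, y, z) ∈ shortPathExceptions ∨
      (m, m * m - s - y - z, y, z) ∈ sporadicExceptions

instance (m s y z : ℕ) : Decidable (SearchOrExceptional m s y z) :=
  inferInstanceAs (Decidable (_ ∨ _ ∨ _))

theorem searchOrExceptional_of_lt_eleven : ∀ m < 11, ∀ y < m * m / 2 + 1, ∀ z < y + 1, ∀ s < 5,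
    SearchOrExceptional m s y z := by
  decide +kernel

theorem coverable_of_lt_eleven {m x y z : ℕ} (hm : m < 11) (hzy : z ≤ y) (hyx : y ≤ x)
    (hs : x + y + z ≤ m ^ 2) (hE : ¬ Exceptional m x y z) : Coverable m ![x, y, z] := by
  rw [sq] at hs
  -- A slack of more than four can be reduced to four by lengthening the longest path.
  obtain ⟨s, hs4, hx, hxs⟩ : ∃ s ≤ 4, x + y + z + s ≤ m * m ∧ (s < 4 → x + y + z + s = m * m) :=
    ⟨min 4 (m * m - (x + y + z)), by omega, by omega, by omega⟩
  obtain h | h | ⟨rfl, h⟩ | h | h :=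
    searchOrExceptional_of_lt_eleven m hm y (by omega) z (by omega) s (by omega)
  · omega
  · exact (Coverable.of_coverSearch h).mono_left (by omega)
  · exact absurd (.inl ⟨by rw [sq]; omega, h⟩) hE
  · have := bounds_of_mem_shortPathExceptions h
    exact absurd (.inr (.inl ⟨s, by rw [sq]; omega, h⟩)) hE
  · have := bounds_of_mem_sporadicExceptions h
    rw [sq] at this
    rw [show m * m - s - y - z = x by omega] at h
    exact absurd (.inr (.inr h)) hE

theorem coverable_of_not_exceptional {m x y z : ℕ} (hzy : z ≤ y) (hyx : y ≤ x)
    (hs : x + y + z ≤ m ^ 2) (hE : ¬ Exceptional m x y z) : Coverable m ![x, y, z] := by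
  induction m generalizing x y z with
  | zero => exact coverable_of_lt_eleven (by norm_num) hzy hyx hs hE
  | succ m ih =>
    obtain hm | hm := Nat.lt_or_ge m 10
    · exact coverable_of_lt_eleven (by omega) hzy hyx hs hE
    have hsq : (m + 1) ^ 2 = m ^ 2 + 2 * m + 1 := by ring
    have hM : 10 * m ≤ m ^ 2 := by nlinarith
    have htwo : ¬ (x + y + z = (m + 1) ^ 2 ∧ (y = 2 ∨ z = 2)) := fun h => hE (.inl h)
    have hshort : ∀ s, x + y + z + s = (m + 1) ^ 2 → (s, y, z) ∉ shortPathExceptions :=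
      fun s h h' => hE (.inr (.inl ⟨s, h, h'⟩))
    refine Coverable.succ_left ?_
    obtain h₁ | h₁ := le_or_gt y (x - (2 * m + 1))
    · refine ih hzy h₁ (by omega) ?_
      rintro (h | ⟨s, h, h'⟩ | h)
      · omega
      · have := bounds_of_mem_shortPathExceptions h'
        exact hshort s (by omega) h'
      · have := bounds_of_mem_sporadicExceptions h
        omega
    obtain h₂ | h₂ := le_or_gt z (x - (2 * m + 1))
    · refine (ih h₂ (by omega) (by omega) ?_).swap_left
      rintro (h | ⟨s, h, h'⟩ | h)
      · omega
      · have := bounds_of_mem_shortPathExceptions h'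
        omega
      · have := bounds_of_mem_sporadicExceptions h
        omega
    · refine (ih (x := y) (y := z) h₂.le hzy (by omega) ?_).swap_right.swap_left
      rintro (h | ⟨s, h, h'⟩ | h)
      · omega
      · have := bounds_of_mem_shortPathExceptions h'
        omega
      · have := bounds_of_mem_sporadicExceptions h
        omega

theorem coverable_two_paths {m x y : ℕ} (hs : x + y ≤ m ^ 2)
    (htwo : ¬ (x + y = m ^ 2 ∧ (x = 2 ∨ y = 2))) : Coverable m ![0, x, y] := by
  wlog h : y ≤ x generalizing x y
  · exact (this (by omega) (by omega) (by omega)).swap_right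
  refine (coverable_of_not_exceptional (Nat.zero_le y) h (by omega) ?_).swap_right.swap_left
  rintro (h | ⟨s, -, h⟩ | h)
  · omega
  · have := bounds_of_mem_shortPathExceptions h
    omega
  · have := bounds_of_mem_sporadicExceptions h
    omega

end Tilings

section Growth

open Finset

variable {V : Type*} [Fintype V] [DecidableEq V] {G : SimpleGraph V} [DecidableRel G.Adj]

/-- The outer vertex boundary of `s`: the vertices outside `s` that are adjacent to some vertex
of `s`. -/
def outerBoundary (G : SimpleGraph V) [DecidableRel G.Adj] (s : Finset V) : Finset V :=
  {v | v ∉ s ∧ ∃ u ∈ s, G.Adj u v}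

theorem mem_outerBoundary {s : Finset V} {v : V} :
    v ∈ outerBoundary G s ↔ v ∉ s ∧ ∃ u ∈ s, G.Adj u v := by
  simp [outerBoundary]

theorem disjoint_insert_outerBoundary {s : Finset V} {x : V} (hx : x ∉ s) :
    Disjoint s (insert x (outerBoundary G s)) :=
  disjoint_insert_right.2 ⟨hx, disjoint_right.2 fun _ hv => (mem_outerBoundary.1 hv).1⟩

theorem card_neighborFinset_sdiff_lt_degree {s : Finset V} {v : V} (hv : v ∈ outerBoundary G s) :
    #(G.neighborFinset v \ s) < G.degree v := by
  obtain ⟨-, u, hu, huv⟩ := mem_outerBoundary.1 hv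
  exact card_lt_card <| (ssubset_iff_of_subset sdiff_subset).2
    ⟨u, (G.mem_neighborFinset v u).2 huv.symm, fun h => (mem_sdiff.1 h).2 hu⟩

theorem card_outerBoundary_union_le (s : Finset V) (x : V) :
    #(outerBoundary G (s ∪ insert x (outerBoundary G s))) ≤
      #(outerBoundary G s) + 2 + ∑ v ∈ insert x (outerBoundary G s), (G.degree v - 2) := by
  have hsub : outerBoundary G (s ∪ insert x (outerBoundary G s)) ⊆
      (insert x (outerBoundary G s)).biUnion fun v => G.neighborFinset v \ s := by
    intro w hw
    obtain ⟨hws, u, hu, huw⟩ := mem_outerBoundary.1 hw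
    simp only [mem_union, mem_insert, mem_outerBoundary, mem_biUnion, mem_sdiff,
      SimpleGraph.mem_neighborFinset] at *
    grind
  have hnew : ∀ v ∈ outerBoundary G s, #(G.neighborFinset v \ s) ≤ 1 + (G.degree v - 2) :=
    fun v hv => by have := card_neighborFinset_sdiff_lt_degree hv; omega
  have hsum : ∑ v ∈ outerBoundary G s, #(G.neighborFinset v \ s) ≤
      #(outerBoundary G s) + ∑ v ∈ outerBoundary G s, (G.degree v - 2) :=
    (sum_le_sum hnew).trans_eq (by simp [sum_add_distrib])
  refine (card_le_card hsub).trans (card_biUnion_le.trans ?_)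
  by_cases hx : x ∈ outerBoundary G s
  · rw [insert_eq_of_mem hx]
    omega
  · have hdeg : #(G.neighborFinset x \ s) ≤ G.degree x := card_le_card sdiff_subset
    rw [sum_insert hx, sum_insert hx]
    omega

theorem BurnsTo.exists_finset {t : ℕ} {B : Set V} (h : BurnsTo G t B) :
    ∃ s : Finset V, (s : Set V) = B ∧
      #(outerBoundary G s) ≤ 2 * t + ∑ v ∈ s, (G.degree v - 2) ∧
      #s ≤ t ^ 2 + t * ∑ v, (G.degree v - 2) := by
  induction h with
  | start => exact ⟨∅, by simp [outerBoundary]⟩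
  | @round t B _ x hx ih =>
    obtain ⟨s, rfl, hbdry, hcard⟩ := ih
    have hdisj := disjoint_insert_outerBoundary (G := G) hx
    refine ⟨s ∪ insert x (outerBoundary G s), ?_, ?_, ?_⟩
    · ext v
      simp only [coe_union, coe_insert, Set.mem_union, Set.mem_insert_iff, mem_coe,
        mem_outerBoundary, Set.mem_ofPred_eq, Set.mem_singleton_iff]
      by_cases hv : v ∈ s <;> simp [hv, or_comm]
    · rw [sum_union hdisj]
      have := card_outerBoundary_union_le (G := G) s x
      omega
    · have hins : #(insert x (outerBoundary G s)) ≤ #(outerBoundary G s) + 1 := card_insert_le _ _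
      have hsum : ∑ v ∈ s, (G.degree v - 2) ≤ ∑ v, (G.degree v - 2) :=
        sum_le_sum_of_subset (subset_univ s)
      rw [card_union_of_disjoint hdisj]
      linarith [add_sq t 1, add_mul t 1 (∑ v, (G.degree v - 2))]

end Growth

theorem IsBurnable.card_lt {V : Type*} [Fintype V] {G : SimpleGraph V} [DecidableRel G.Adj] {k : ℕ}
    (hG : ∑ v, (G.degree v - 2) ≤ 2) (h : IsBurnable G k) : Fintype.card V < (k + 1) ^ 2 := by
  classical
  obtain ⟨t, htk, h⟩ := h
  obtain ⟨s, hs, -, hcard⟩ := h.exists_finset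
  rw [Finset.coe_eq_univ.1 hs, Finset.card_univ] at hcard
  calc Fintype.card V ≤ t ^ 2 + t * 2 := hcard.trans (by gcongr)
    _ < (t + 1) ^ 2 := by linarith [add_sq t 1]
    _ ≤ (k + 1) ^ 2 := by gcongr

section Burning

variable {V : Type*} {G : SimpleGraph V}

theorem edist_le_or_exists_adj {u v : V} {r : ℕ} (h : G.edist u v ≤ (r + 1 : ℕ)) :
    G.edist u v ≤ r ∨ ∃ w, G.edist u w ≤ r ∧ G.Adj w v := by
  rw [G.edist_comm] at h
  obtain ⟨p, hp⟩ := SimpleGraph.exists_walk_of_edist_ne_top (ne_top_of_le_ne_top (by simp) h)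
  rw [← hp] at h
  cases p with
  | nil => exact .inl (by simp)
  | @cons _ w _ hvw p =>
    refine .inr ⟨w, ?_, hvw.symm⟩
    rw [G.edist_comm]
    exact (SimpleGraph.edist_le p).trans (by simpa using h)

theorem exists_burnsTo (x : ℕ → V) (t : ℕ) : IsBurnable G t ∨
    ∃ B, BurnsTo G t B ∧ ∀ s r : ℕ, s + r < t → ∀ v, G.edist (x s) v ≤ r → v ∈ B := by
  induction t with
  | zero => exact .inr ⟨∅, .start, by simp⟩
  | succ t ih =>
    obtain ⟨t', ht', h⟩ | ⟨B, hB, h⟩ := ih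
    · exact .inl ⟨t', ht'.trans t.le_succ, h⟩
    obtain rfl | hne := eq_or_ne B Set.univ
    · exact .inl ⟨t, t.le_succ, hB⟩
    obtain ⟨y, hy, hxy⟩ : ∃ y ∉ B, x t = y ∨ x t ∈ B := by
      by_cases hx : x t ∈ B
      · obtain ⟨y, hy⟩ := (Set.ne_univ_iff_exists_notMem B).1 hne
        exact ⟨y, hy, .inr hx⟩
      · exact ⟨x t, hx, .inl rfl⟩
    refine .inr ⟨_, hB.round y hy, ?_⟩
    rintro s (_ | r) hs v hv
    · obtain rfl : x s = v := by simpa using hv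
      obtain rfl | hs := eq_or_ne s t
      · exact hxy.symm.imp_left .inl
      · exact .inl (.inl (h s 0 (by omega) _ (by simp)))
    · obtain hv | ⟨w, hw, hwv⟩ := edist_le_or_exists_adj hv
      · exact .inl (.inl (h s r (by omega) v hv))
      · exact .inl (.inr ⟨w, h s r (by omega) w hw, hwv⟩)

theorem isBurnable_of_edist_le {k : ℕ} (c : ℕ → V) (hc : ∀ v, ∃ i < k, G.edist (c i) v ≤ i) :
    IsBurnable G k := by
  obtain h | ⟨B, hB, h⟩ := exists_burnsTo (G := G) (fun s => c (k - 1 - s)) k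
  · exact h
  refine ⟨k, le_rfl, ?_⟩
  suffices hB_univ : B = Set.univ from hB_univ ▸ hB
  refine Set.eq_univ_of_forall fun v => ?_
  obtain ⟨i, hi, hv⟩ := hc v
  exact h (k - 1 - i) i (by omega) v (by rwa [show k - 1 - (k - 1 - i) = i by omega])

/-- The vertices `f 0, …, f (n - 1)` form a walk in `G`. -/
def AdjChain (G : SimpleGraph V) (f : ℕ → V) (n : ℕ) : Prop :=
  ∀ j, j + 1 < n → G.Adj (f j) (f (j + 1))

namespace AdjChain

variable {f : ℕ → V} {n : ℕ}

theorem mono {k : ℕ} (hf : AdjChain G f n) (hk : k ≤ n) : AdjChain G f k :=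
  fun j hj => hf j (hj.trans_le hk)

theorem edist_add_le (hf : AdjChain G f n) {i k : ℕ} (h : i + k < n) :
    G.edist (f i) (f (i + k)) ≤ k := by
  induction k with
  | zero => simp
  | succ k ih =>
    calc G.edist (f i) (f (i + (k + 1)))
        ≤ G.edist (f i) (f (i + k)) + G.edist (f (i + k)) (f (i + (k + 1))) := G.edist_triangle
      _ ≤ k + 1 := add_le_add (ih (by omega)) (SimpleGraph.edist_eq_one_iff_adj.2 (hf _ h)).le
      _ = (k + 1 : ℕ) := by push_cast; rfl

theorem edist_le (hf : AdjChain G f n) {i j r : ℕ} (hi : i < n) (hj : j < n) (hij : i ≤ j + r)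
    (hji : j ≤ i + r) : G.edist (f i) (f j) ≤ r := by
  wlog h : i ≤ j generalizing i j
  · rw [G.edist_comm]
    exact this hj hi hji hij (by omega)
  obtain ⟨k, rfl⟩ := Nat.exists_eq_add_of_le h
  exact (hf.edist_add_le hj).trans (by exact_mod_cast by omega)

end AdjChain

variable {ι : Type*} [DecidableEq ι] {f : ι → ℕ → V} {m : ℕ} {x : ι → ℕ}

theorem Coverable.exists_centers (h : Coverable m x) (hf : ∀ i, AdjChain G (f i) (x i)) :
    ∃ c : ℕ → V, ∀ i, ∀ j < x i, ∃ k < m, G.edist (c k) (f i j) ≤ k := by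
  induction m generalizing x with
  | zero =>
    obtain ⟨σ, hσ⟩ := h
    exact ⟨f (σ 0), fun i j hj => absurd (hσ i) (by simp; omega)⟩
  | succ m ih =>
    obtain ⟨i₀, h⟩ := succ_iff.1 h
    have hle : Function.update x i₀ (x i₀ - (2 * m + 1)) ≤ x :=
      update_le_self_iff.2 (Nat.sub_le _ _)
    obtain ⟨c, hc⟩ := ih h fun i => (hf i).mono (hle i)
    refine ⟨Function.update c m (f i₀ (x i₀ - 1 - m)), fun i j hj => ?_⟩
    by_cases hij : j < Function.update x i₀ (x i₀ - (2 * m + 1)) i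
    · obtain ⟨k, hk, hck⟩ := hc i j hij
      exact ⟨k, hk.trans m.lt_succ_self, by rwa [Function.update_of_ne hk.ne]⟩
    · obtain rfl : i = i₀ := by
        by_contra hne
        exact hij (by rwa [Function.update_of_ne hne])
      rw [Function.update_self] at hij
      refine ⟨m, m.lt_succ_self, ?_⟩
      rw [Function.update_self]
      exact (hf i).edist_le (by omega) hj (by omega) (by omega)

theorem isBurnable_of_coverable (h : Coverable m x) (hf : ∀ i, AdjChain G (f i) (x i)) (c₀ : V)
    (hc₀ : ∀ v, G.edist c₀ v ≤ m ∨ ∃ i, ∃ j < x i, f i j = v) : IsBurnable G (m + 1) := by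
  obtain ⟨c, hc⟩ := h.exists_centers hf
  refine isBurnable_of_edist_le (Function.update c m c₀) fun v => ?_
  obtain hv | ⟨i, j, hj, rfl⟩ := hc₀ v
  · exact ⟨m, m.lt_succ_self, by rwa [Function.update_self]⟩
  · obtain ⟨k, hk, hck⟩ := hc i j hj
    exact ⟨k, hk.trans m.lt_succ_self, by rwa [Function.update_of_ne hk.ne]⟩

end Burning

theorem AdjChain.shift {V : Type*} {G : SimpleGraph V} {f : ℕ → V} {n : ℕ}
    (hf : AdjChain G f n) (k : ℕ) : AdjChain G (fun j => f (k + j)) (n - k) :=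
  fun j hj => hf (k + j) (by omega)

theorem degree_le_two {V : Type*} [Fintype V] {G : SimpleGraph V} [DecidableRel G.Adj]
    {v x y : V} (h : ∀ w, G.Adj v w → w = x ∨ w = y) : G.degree v ≤ 2 := by
  classical
  refine (Finset.card_le_card (t := {x, y}) fun w hw => ?_).trans Finset.card_le_two
  simpa using h w ((G.mem_neighborFinset v w).1 hw)

theorem cycleGraph_adj_iff {g : ℕ} [NeZero g] (hg : 2 ≤ g) {u v : Fin g} :
    (SimpleGraph.cycleGraph g).Adj u v ↔ v = u + 1 ∨ v = u - 1 := by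
  obtain ⟨n, rfl⟩ : ∃ n, g = n + 2 := ⟨g - 2, by omega⟩
  rw [SimpleGraph.cycleGraph_adj, sub_eq_iff_eq_add', sub_eq_iff_eq_add', or_comm,
    eq_sub_iff_add_eq, eq_comm (a := u)]

namespace unicyclicGraph

variable {g a₁ a₂ : ℕ}

section Adjacency

variable {i i' : Fin g} {j j' : Fin a₁} {k k' : Fin a₂}

theorem adj_inl_inl : (unicyclicGraph g a₁ a₂).Adj (.inl i) (.inl i') ↔
    (SimpleGraph.cycleGraph g).Adj i i' := by
  simp only [unicyclicGraph, SimpleGraph.fromRel_adj, ne_eq, Sum.inl.injEq,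
    SimpleGraph.adj_comm _ i' i, or_self, and_iff_right_iff_imp]
  exact fun h => h.ne

theorem adj_inl_arm₁ : (unicyclicGraph g a₁ a₂).Adj (.inl i) (.inr (.inl j)) ↔
    i.val = 0 ∧ j.val = 0 := by
  simp [unicyclicGraph]

theorem adj_inl_arm₂ : (unicyclicGraph g a₁ a₂).Adj (.inl i) (.inr (.inr k)) ↔
    i.val = 0 ∧ k.val = 0 := by
  simp [unicyclicGraph]

theorem adj_arm₁_arm₁ : (unicyclicGraph g a₁ a₂).Adj (.inr (.inl j)) (.inr (.inl j')) ↔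
    j.val + 1 = j'.val ∨ j'.val + 1 = j.val := by
  simp only [unicyclicGraph, SimpleGraph.fromRel_adj, SimpleGraph.pathGraph_adj, ne_eq,
    Sum.inr.injEq, Sum.inl.injEq, Fin.ext_iff]
  omega

theorem adj_arm₂_arm₂ : (unicyclicGraph g a₁ a₂).Adj (.inr (.inr k)) (.inr (.inr k')) ↔
    k.val + 1 = k'.val ∨ k'.val + 1 = k.val := by
  simp only [unicyclicGraph, SimpleGraph.fromRel_adj, SimpleGraph.pathGraph_adj, ne_eq,
    Sum.inr.injEq, Fin.ext_iff]
  omega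

theorem not_adj_arm₁_arm₂ : ¬ (unicyclicGraph g a₁ a₂).Adj (.inr (.inl j)) (.inr (.inr k)) := by
  simp [unicyclicGraph]

end Adjacency

variable [NeZero g]

variable (g a₁ a₂) in
/-- The vertex of the cycle with index `i` modulo `g`; index `0` is the hub. -/
def cycle (i : ℕ) : Fin g ⊕ Fin a₁ ⊕ Fin a₂ :=
  .inl (Fin.ofNat g i)

variable (g a₁ a₂) in
/-- The vertex at distance `j ≤ a₁` from the hub on the first pendant path. -/
def arm₁ : ℕ → Fin g ⊕ Fin a₁ ⊕ Fin a₂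
  | 0 => cycle g a₁ a₂ 0
  | j + 1 => if h : j < a₁ then .inr (.inl ⟨j, h⟩) else cycle g a₁ a₂ 0

variable (g a₁ a₂) in
/-- The vertex at distance `j ≤ a₂` from the hub on the second pendant path. -/
def arm₂ : ℕ → Fin g ⊕ Fin a₁ ⊕ Fin a₂
  | 0 => cycle g a₁ a₂ 0
  | j + 1 => if h : j < a₂ then .inr (.inr ⟨j, h⟩) else cycle g a₁ a₂ 0

theorem adjChain_cycle (hg : 2 ≤ g) (n : ℕ) :
    AdjChain (unicyclicGraph g a₁ a₂) (cycle g a₁ a₂) n := fun i _ =>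
  adj_inl_inl.2 <| (cycleGraph_adj_iff hg).2 <| .inl <| by
    ext
    simp [Fin.val_add]

theorem adjChain_arm₁ : AdjChain (unicyclicGraph g a₁ a₂) (arm₁ g a₁ a₂) (a₁ + 1) := by
  rintro (_ | j) hj
  · simp only [arm₁, cycle, show 0 < a₁ by omega, dif_pos, adj_inl_arm₁]
    simp
  · simp only [arm₁, show j < a₁ by omega, show j + 1 < a₁ by omega, dif_pos, adj_arm₁_arm₁]
    simp

theorem adjChain_arm₂ : AdjChain (unicyclicGraph g a₁ a₂) (arm₂ g a₁ a₂) (a₂ + 1) := by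
  rintro (_ | j) hj
  · simp only [arm₂, cycle, show 0 < a₂ by omega, dif_pos, adj_inl_arm₂]
    simp
  · simp only [arm₂, show j < a₂ by omega, show j + 1 < a₂ by omega, dif_pos, adj_arm₂_arm₂]
    simp

theorem arm₁_succ (j : Fin a₁) : arm₁ g a₁ a₂ (j + 1) = .inr (.inl j) :=
  dif_pos j.isLt

theorem arm₂_succ (j : Fin a₂) : arm₂ g a₁ a₂ (j + 1) = .inr (.inr j) :=
  dif_pos j.isLt

theorem inl_eq_cycle (i : Fin g) : .inl i = cycle g a₁ a₂ i :=
  congrArg Sum.inl (Fin.ofNat_val_eq_self i).symm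

theorem inl_eq_cycle_zero {i : Fin g} (hi : i.val = 0) : .inl i = cycle g a₁ a₂ 0 :=
  hi ▸ inl_eq_cycle i

section Degree

variable [DecidableRel (unicyclicGraph g a₁ a₂).Adj]

theorem degree_hub_le_four (hg : 2 ≤ g) :
    (unicyclicGraph g a₁ a₂).degree (cycle g a₁ a₂ 0) ≤ 4 := by
  refine (Finset.card_le_card (t := {.inl 1, .inl (-1), arm₁ g a₁ a₂ 1, arm₂ g a₁ a₂ 1})
    fun w hw => ?_).trans Finset.card_le_four
  rw [SimpleGraph.mem_neighborFinset] at hw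
  obtain i | j | k := w
  · have := (cycleGraph_adj_iff hg).1 (adj_inl_inl.1 hw)
    grind [zero_add, zero_sub]
  · simp [← arm₁_succ j, (adj_inl_arm₁.1 hw).2]
  · simp [← arm₂_succ k, (adj_inl_arm₂.1 hw).2]

theorem degree_inl_le_two (hg : 2 ≤ g) {i : Fin g} (hi : i.val ≠ 0) :
    (unicyclicGraph g a₁ a₂).degree (.inl i) ≤ 2 := by
  refine degree_le_two (x := .inl (i + 1)) (y := .inl (i - 1)) ?_
  rintro (i' | j | k) h
  · simpa [cycleGraph_adj_iff hg] using adj_inl_inl.1 h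
  · exact absurd (adj_inl_arm₁.1 h).1 hi
  · exact absurd (adj_inl_arm₂.1 h).1 hi

theorem degree_arm₁_le_two (j : Fin a₁) :
    (unicyclicGraph g a₁ a₂).degree (.inr (.inl j)) ≤ 2 := by
  refine degree_le_two (x := arm₁ g a₁ a₂ j) (y := arm₁ g a₁ a₂ (j + 2)) ?_
  rintro (i | j' | k) h
  · obtain ⟨hi, hj⟩ := adj_inl_arm₁.1 h.symm
    exact .inl (by rw [hj, inl_eq_cycle_zero hi, arm₁])
  · obtain h | h := adj_arm₁_arm₁.1 h
    · exact .inr (by rw [← arm₁_succ j', ← h])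
    · exact .inl (by rw [← arm₁_succ j', ← h])
  · exact absurd h not_adj_arm₁_arm₂

theorem degree_arm₂_le_two (k : Fin a₂) :
    (unicyclicGraph g a₁ a₂).degree (.inr (.inr k)) ≤ 2 := by
  refine degree_le_two (x := arm₂ g a₁ a₂ k) (y := arm₂ g a₁ a₂ (k + 2)) ?_
  rintro (i | j | k') h
  · obtain ⟨hi, hk⟩ := adj_inl_arm₂.1 h.symm
    exact .inl (by rw [hk, inl_eq_cycle_zero hi, arm₂])
  · exact absurd h.symm not_adj_arm₁_arm₂
  · obtain h | h := adj_arm₂_arm₂.1 h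
    · exact .inr (by rw [← arm₂_succ k', ← h])
    · exact .inl (by rw [← arm₂_succ k', ← h])

theorem sum_degree_sub_two_le (hg : 2 ≤ g) :
    ∑ v, ((unicyclicGraph g a₁ a₂).degree v - 2) ≤ 2 := by
  rw [Fintype.sum_eq_single (cycle g a₁ a₂ 0) fun v hv => Nat.sub_eq_zero_of_le ?_]
  · exact Nat.sub_le_sub_right (degree_hub_le_four hg) 2
  · obtain i | j | k := v
    · exact degree_inl_le_two hg fun hi => hv (inl_eq_cycle_zero hi)
    · exact degree_arm₁_le_two j
    · exact degree_arm₂_le_two k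

end Degree

theorem le_of_isBurnable (hg : 2 ≤ g) {q k : ℕ} (hq : q ^ 2 ≤ g + a₁ + a₂)
    (h : IsBurnable (unicyclicGraph g a₁ a₂) k) : q ≤ k := by
  classical
  have hk := h.card_lt (sum_degree_sub_two_le hg)
  simp only [Fintype.card_sum, Fintype.card_fin] at hk
  exact Nat.lt_succ_iff.1 (lt_of_pow_lt_pow_left₀ 2 (Nat.zero_le _) (lt_of_le_of_lt hq (by
    rwa [Nat.add_assoc])))

theorem edist_hub_cycle_le (hg : 2 ≤ g) {i r : ℕ} (hi : i < g) (h : i ≤ r ∨ g ≤ i + r) :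
    (unicyclicGraph g a₁ a₂).edist (cycle g a₁ a₂ 0) (cycle g a₁ a₂ i) ≤ r := by
  obtain h | h := h
  · exact (adjChain_cycle hg g).edist_le (by omega) hi (by omega) (by omega)
  · rw [show cycle g a₁ a₂ 0 = cycle g a₁ a₂ g by simp [cycle]]
    exact (adjChain_cycle hg (g + 1)).edist_le (by omega) (by omega) (by omega) (by omega)

theorem edist_arm₁_le {d r m : ℕ} {v : Fin g ⊕ Fin a₁ ⊕ Fin a₂} (hd : d ≤ a₁)
    (hv : (unicyclicGraph g a₁ a₂).edist (cycle g a₁ a₂ 0) v ≤ r) (hm : d + r ≤ m) :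
    (unicyclicGraph g a₁ a₂).edist (arm₁ g a₁ a₂ d) v ≤ m := by
  have hhub := (adjChain_arm₁ (g := g) (a₁ := a₁) (a₂ := a₂)).edist_le (i := d) (j := 0) (r := d)
    (by omega) (by omega) (by omega) (by omega)
  calc _ ≤ (d : ℕ∞) + r := SimpleGraph.edist_triangle.trans (add_le_add hhub hv)
    _ ≤ m := by exact_mod_cast hm

theorem isBurnable_of_coverable (hg : 2 ≤ g) {m d : ℕ} (hdm : d ≤ m) (hda : d ≤ a₁)
    (h : Coverable m ![g - (2 * (m - d) + 1), a₁ - (m + d), a₂ - (m - d)]) :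
    IsBurnable (unicyclicGraph g a₁ a₂) (m + 1) := by
  refine _root_.isBurnable_of_coverable h
    (f := ![fun j => cycle g a₁ a₂ (m - d + 1 + j), fun j => arm₁ g a₁ a₂ (m + d + 1 + j),
      fun j => arm₂ g a₁ a₂ (m - d + 1 + j)]) ?_ (arm₁ g a₁ a₂ d) fun v => ?_
  · simp only [Fin.forall_fin_succ]
    exact ⟨((adjChain_cycle hg g).shift _).mono
        (show g - (2 * (m - d) + 1) ≤ g - (m - d + 1) by omega),
      (adjChain_arm₁.shift _).mono (show a₁ - (m + d) ≤ a₁ + 1 - (m + d + 1) by omega),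
      (adjChain_arm₂.shift _).mono (show a₂ - (m - d) ≤ a₂ + 1 - (m - d + 1) by omega),
      fun i => i.elim0⟩
  obtain i | j | k := v
  · rw [inl_eq_cycle]
    by_cases hi : i.val ≤ m - d ∨ g ≤ i.val + (m - d)
    · exact .inl (edist_arm₁_le hda (edist_hub_cycle_le hg i.isLt hi) (by omega))
    · exact .inr ⟨0, i - (m - d + 1), show i - (m - d + 1) < g - (2 * (m - d) + 1) by omega,
        congrArg (cycle g a₁ a₂) (by omega)⟩
  · rw [← arm₁_succ]
    by_cases hj : j + 1 ≤ m + d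
    · exact .inl (adjChain_arm₁.edist_le (by omega) (by omega) (by omega) (by omega))
    · exact .inr ⟨1, j - (m + d), show j - (m + d) < a₁ - (m + d) by omega,
        congrArg (arm₁ g a₁ a₂) (by omega)⟩
  · rw [← arm₂_succ]
    by_cases hk : k + 1 ≤ m - d
    · exact .inl (edist_arm₁_le hda
        (adjChain_arm₂.edist_le (i := 0) (r := m - d) (by omega) (by omega) (by omega) (by omega))
        (by omega))
    · exact .inr ⟨2, k - (m - d), show k - (m - d) < a₂ - (m - d) by omega,
        congrArg (arm₂ g a₁ a₂) (by omega)⟩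

end unicyclicGraph

section ExceptionalFamilies

theorem longest_of_mem_shortPathExceptions (q : ℤ) {s y z : ℕ}
    (h : (s, y, z) ∈ shortPathExceptions) :
    (q ^ 2 - s - y - z, q - 1 + y, q - 1 + z) ∈ exceptB1 q ∪ exceptC2 q ∪ exceptC3 q ∨
      (s = 2 ∨ s = 3) ∧ y = 2 ∧ z = 2 := by
  simp only [exceptB1, exceptC2, exceptC3, Set.mem_union, Set.mem_insert_iff,
    Set.mem_singleton_iff, Prod.mk.injEq, or_assoc]
  simp only [shortPathExceptions, List.mem_cons, Prod.mk.injEq, List.not_mem_nil, or_false] at h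
  generalize q ^ 2 = Q
  casesm* _ ∨ _ <;> repeat first | exact .inl (by omega) | refine .inr ?_
  all_goals omega

theorem middle_of_mem_shortPathExceptions (q : ℤ) {s y z : ℕ}
    (h : (s, y, z) ∈ shortPathExceptions) :
    (2 * q - 1 + y, q ^ 2 - q - s - y - z, q - 1 + z) ∈
        exceptB2 q ∪ exceptC2 q ∪ exceptC3 q ∨
      s + y = 5 ∧ (y = 2 ∨ y = 3) ∧ z = 2 := by
  simp only [exceptB2, exceptC2, exceptC3, Set.mem_union, Set.mem_insert_iff,
    Set.mem_singleton_iff, Prod.mk.injEq, or_assoc]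
  simp only [shortPathExceptions, List.mem_cons, Prod.mk.injEq, List.not_mem_nil, or_false] at h
  generalize q ^ 2 = Q
  casesm* _ ∨ _ <;> repeat first | exact .inl (by omega) | refine .inr ?_
  all_goals omega

theorem shortest_of_mem_shortPathExceptions (q : ℤ) {s y z : ℕ}
    (h : (s, y, z) ∈ shortPathExceptions) (hzy : z < y) :
    (2 * q - 1 + z, q ^ 2 - q - s - y - z, q - 1 + y) ∈
      exceptB3 q ∪ exceptC2 q ∪ exceptC3 q := by
  simp only [exceptB3, exceptC2, exceptC3, Set.mem_union, Set.mem_insert_iff,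
    Set.mem_singleton_iff, Prod.mk.injEq, or_assoc]
  simp only [shortPathExceptions, List.mem_cons, Prod.mk.injEq, List.not_mem_nil, or_false] at h
  generalize q ^ 2 = Q
  casesm* _ ∨ _ <;> repeat first | exact .inl (by omega) | refine .inr ?_

theorem longest_of_mem_sporadicExceptions {m x y z : ℕ} (h : (m, x, y, z) ∈ sporadicExceptions) :
    ((2 * m + 1 + x : ℤ), (m + y : ℤ), (m + z : ℤ)) ∈ exceptB4 ∪ exceptC3 (m + 1) := by
  simp only [exceptB4, exceptC3, Set.mem_union, Set.mem_insert_iff, Set.mem_singleton_iff,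
    Prod.mk.injEq]
  simp only [sporadicExceptions, List.mem_cons, Prod.mk.injEq, List.not_mem_nil, or_false] at h
  casesm* _ ∨ _ <;> obtain ⟨rfl, rfl, rfl, rfl⟩ := h <;> norm_num

theorem middle_of_mem_sporadicExceptions {m x y z : ℕ} (h : (m, x, y, z) ∈ sporadicExceptions) :
    ((2 * m + 1 + y : ℤ), (m + x : ℤ), (m + z : ℤ)) ∈ exceptB5 ∪ exceptC3 (m + 1) := by
  simp only [exceptB5, exceptC3, Set.mem_union, Set.mem_insert_iff, Set.mem_singleton_iff,
    Prod.mk.injEq]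
  simp only [sporadicExceptions, List.mem_cons, Prod.mk.injEq, List.not_mem_nil, or_false] at h
  casesm* _ ∨ _ <;> obtain ⟨rfl, rfl, rfl, rfl⟩ := h <;> norm_num

theorem shortest_of_mem_sporadicExceptions {m x y z : ℕ} (h : (m, x, y, z) ∈ sporadicExceptions) :
    ((2 * m + 1 + z : ℤ), (m + x : ℤ), (m + y : ℤ)) ∈ exceptB6 ∪ exceptC3 (m + 1) := by
  simp only [exceptB6, exceptC3, Set.mem_union, Set.mem_insert_iff, Set.mem_singleton_iff,
    Prod.mk.injEq]
  simp only [sporadicExceptions, List.mem_cons, Prod.mk.injEq, List.not_mem_nil, or_false] at h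
  casesm* _ ∨ _ <;> obtain ⟨rfl, rfl, rfl, rfl⟩ := h <;> norm_num

section Residual

variable {g a₁ a₂ m r : ℕ}

-- The cover leaves residual paths with `g - (2 * m + 1)`, `a₁ - m` and `a₂ - m` vertices when the
-- longest ball is centred at the hub; the lemmas are named for the rank of the one on the cycle.
theorem mem_exceptC_of_longest_of_eq_sq (hn : g + a₁ + a₂ = (m + 1) ^ 2 + r)
    (h₁ : a₁ - m ≤ g - (2 * m + 1)) (h₂ : a₂ - m ≤ a₁ - m)
    (hs : g - (2 * m + 1) + (a₁ - m) + (a₂ - m) = m ^ 2) (h : a₁ - m = 2 ∨ a₂ - m = 2) :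
    ((g : ℤ), (a₁ : ℤ), (a₂ : ℤ)) ∈ exceptC (m + 1) r := by
  have hsq : ((m : ℤ) + 1) ^ 2 = (m ^ 2 : ℕ) + 2 * m + 1 := by push_cast; ring
  have hsq' : (m + 1) ^ 2 = m ^ 2 + 2 * m + 1 := by ring
  suffices ((g : ℤ), (a₁ : ℤ), (a₂ : ℤ)) ∈ exceptC1 (m + 1) r ∪ exceptC4 (m + 1) by
    simp only [exceptC, Set.mem_union] at this ⊢
    tauto
  simp only [exceptC1, exceptC4, exceptB1, Set.mem_union, Set.mem_insert_iff,
    Set.mem_singleton_iff, Set.mem_ofPred_eq, Prod.mk.injEq, or_assoc, hsq]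
  generalize m ^ 2 = M at *
  obtain h | h | h : a₂ - m = 2 ∨ a₁ - m = 2 ∧ a₂ - m = 1 ∨ a₁ - m = 2 ∧ a₂ - m = 0 := by omega
  all_goals repeat first | exact .inl (by omega) | refine .inr ?_

theorem mem_exceptC_of_middle_of_eq_sq (hn : g + a₁ + a₂ = (m + 1) ^ 2 + r)
    (h₁ : g - (2 * m + 1) ≤ a₁ - m)
    (h₂ : a₂ - m ≤ g - (2 * m + 1))
    (hs : g - (2 * m + 1) + (a₁ - m) + (a₂ - m) = m ^ 2)
    (h : g - (2 * m + 1) = 2 ∨ a₂ - m = 2) :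
    ((g : ℤ), (a₁ : ℤ), (a₂ : ℤ)) ∈ exceptC (m + 1) r := by
  have hsq : ((m : ℤ) + 1) ^ 2 = (m ^ 2 : ℕ) + 2 * m + 1 := by push_cast; ring
  have hsq' : (m + 1) ^ 2 = m ^ 2 + 2 * m + 1 := by ring
  suffices ((g : ℤ), (a₁ : ℤ), (a₂ : ℤ)) ∈ exceptC1 (m + 1) r ∪ exceptC5 (m + 1) by
    simp only [exceptC, Set.mem_union] at this ⊢
    tauto
  simp only [exceptC1, exceptC5, exceptB2, Set.mem_union, Set.mem_insert_iff,
    Set.mem_singleton_iff, Set.mem_ofPred_eq, Prod.mk.injEq, or_assoc, hsq]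
  generalize m ^ 2 = M at *
  obtain h | h | h : a₂ - m = 2 ∨ g - (2 * m + 1) = 2 ∧ a₂ - m = 1 ∨
    g - (2 * m + 1) = 2 ∧ a₂ - m = 0 := by omega
  all_goals repeat first | exact .inl (by omega) | refine .inr ?_

theorem mem_exceptC_of_shortest_of_eq_sq (hg : 2 * (m + 1) ≤ g)
    (h₁ : a₂ - m ≤ a₁ - m) (h₂ : g - (2 * m + 1) < a₂ - m)
    (hs : g - (2 * m + 1) + (a₁ - m) + (a₂ - m) = m ^ 2)
    (h : a₂ - m = 2 ∨ g - (2 * m + 1) = 2) :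
    ((g : ℤ), (a₁ : ℤ), (a₂ : ℤ)) ∈ exceptC (m + 1) r := by
  have hsq : ((m : ℤ) + 1) ^ 2 = (m ^ 2 : ℕ) + 2 * m + 1 := by push_cast; ring
  suffices ((g : ℤ), (a₁ : ℤ), (a₂ : ℤ)) ∈ exceptC6 (m + 1) by
    simp only [exceptC, Set.mem_union] at this ⊢
    tauto
  simp only [exceptC6, exceptB3, Set.mem_union, Set.mem_insert_iff,
    Set.mem_singleton_iff, Set.mem_ofPred_eq, Prod.mk.injEq, or_assoc, hsq]
  generalize m ^ 2 = M at *
  obtain h | h : g - (2 * m + 1) = 2 ∨ a₂ - m = 2 ∧ g - (2 * m + 1) = 1 := by omega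
  all_goals repeat first | exact .inl (by omega) | refine .inr ?_

theorem mem_exceptC_of_longest (hn : g + a₁ + a₂ = (m + 1) ^ 2 + r)
    (h₁ : a₁ - m ≤ g - (2 * m + 1)) (h₂ : a₂ - m ≤ a₁ - m)
    (hE : Exceptional m (g - (2 * m + 1)) (a₁ - m) (a₂ - m)) :
    ((g : ℤ), (a₁ : ℤ), (a₂ : ℤ)) ∈ exceptC (m + 1) r ∨
      a₁ = m + 2 ∧ a₂ = m + 2 ∧ (g - (2 * m + 1) + 6 = m ^ 2 ∨ g - (2 * m + 1) + 7 = m ^ 2) := by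
  have hsq : ((m : ℤ) + 1) ^ 2 = (m ^ 2 : ℕ) + 2 * m + 1 := by push_cast; ring
  obtain ⟨hs, h⟩ | ⟨s, hs, h⟩ | h := hE
  · exact .inl (mem_exceptC_of_longest_of_eq_sq hn h₁ h₂ hs h)
  · have := bounds_of_mem_shortPathExceptions h
    refine (longest_of_mem_shortPathExceptions (m + 1) h).imp (fun h' => ?_) (by omega)
    rw [show ((m : ℤ) + 1) ^ 2 - s - (a₁ - m : ℕ) - (a₂ - m : ℕ) = g by omega,
      show (m : ℤ) + 1 - 1 + (a₁ - m : ℕ) = a₁ by omega,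
      show (m : ℤ) + 1 - 1 + (a₂ - m : ℕ) = a₂ by omega] at h'
    simp only [exceptC, exceptC4, Set.mem_union] at h' ⊢
    tauto
  · left
    have := bounds_of_mem_sporadicExceptions h
    have h' := longest_of_mem_sporadicExceptions h
    rw [show 2 * (m : ℤ) + 1 + (g - (2 * m + 1) : ℕ) = g by omega,
      show (m : ℤ) + (a₁ - m : ℕ) = a₁ by omega,
      show (m : ℤ) + (a₂ - m : ℕ) = a₂ by omega] at h'
    simp only [exceptC, exceptC4, Set.mem_union] at h' ⊢
    tauto

theorem mem_exceptC_of_middle (hn : g + a₁ + a₂ = (m + 1) ^ 2 + r)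
    (h₁ : g - (2 * m + 1) ≤ a₁ - m) (h₂ : a₂ - m ≤ g - (2 * m + 1))
    (hE : Exceptional m (a₁ - m) (g - (2 * m + 1)) (a₂ - m)) :
    ((g : ℤ), (a₁ : ℤ), (a₂ : ℤ)) ∈ exceptC (m + 1) r ∨
      (g = 2 * m + 3 ∨ g = 2 * m + 4) ∧ a₂ = m + 2 ∧ a₁ - m + 7 = m ^ 2 := by
  have hsq : ((m : ℤ) + 1) ^ 2 = (m ^ 2 : ℕ) + 2 * m + 1 := by push_cast; ring
  obtain ⟨hs, h⟩ | ⟨s, hs, h⟩ | h := hE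
  · exact .inl (mem_exceptC_of_middle_of_eq_sq hn h₁ h₂ (by omega) h)
  · have := bounds_of_mem_shortPathExceptions h
    refine (middle_of_mem_shortPathExceptions (m + 1) h).imp (fun h' => ?_) (by omega)
    rw [show 2 * ((m : ℤ) + 1) - 1 + (g - (2 * m + 1) : ℕ) = g by omega,
      show ((m : ℤ) + 1) ^ 2 - ((m : ℤ) + 1) - s - (g - (2 * m + 1) : ℕ) - (a₂ - m : ℕ) = a₁ by
        omega,
      show (m : ℤ) + 1 - 1 + (a₂ - m : ℕ) = a₂ by omega] at h'
    simp only [exceptC, exceptC5, Set.mem_union] at h' ⊢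
    tauto
  · left
    have := bounds_of_mem_sporadicExceptions h
    have h' := middle_of_mem_sporadicExceptions h
    rw [show 2 * (m : ℤ) + 1 + (g - (2 * m + 1) : ℕ) = g by omega,
      show (m : ℤ) + (a₁ - m : ℕ) = a₁ by omega,
      show (m : ℤ) + (a₂ - m : ℕ) = a₂ by omega] at h'
    simp only [exceptC, exceptC5, Set.mem_union] at h' ⊢
    tauto

theorem mem_exceptC_of_shortest (hg : 2 * (m + 1) ≤ g) (h₁ : a₂ - m ≤ a₁ - m)
    (h₂ : g - (2 * m + 1) < a₂ - m)
    (hE : Exceptional m (a₁ - m) (a₂ - m) (g - (2 * m + 1))) :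
    ((g : ℤ), (a₁ : ℤ), (a₂ : ℤ)) ∈ exceptC (m + 1) r := by
  have hsq : ((m : ℤ) + 1) ^ 2 = (m ^ 2 : ℕ) + 2 * m + 1 := by push_cast; ring
  obtain ⟨hs, h⟩ | ⟨s, hs, h⟩ | h := hE
  · exact mem_exceptC_of_shortest_of_eq_sq hg h₁ h₂ (by omega) h
  · have := bounds_of_mem_shortPathExceptions h
    have h' := shortest_of_mem_shortPathExceptions (m + 1) h h₂
    rw [show 2 * ((m : ℤ) + 1) - 1 + (g - (2 * m + 1) : ℕ) = g by omega,
      show ((m : ℤ) + 1) ^ 2 - ((m : ℤ) + 1) - s - (a₂ - m : ℕ) - (g - (2 * m + 1) : ℕ) = a₁ by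
        omega,
      show (m : ℤ) + 1 - 1 + (a₂ - m : ℕ) = a₂ by omega] at h'
    simp only [exceptC, exceptC6, Set.mem_union] at h' ⊢
    tauto
  · have := bounds_of_mem_sporadicExceptions h
    have h' := shortest_of_mem_sporadicExceptions h
    rw [show 2 * (m : ℤ) + 1 + (g - (2 * m + 1) : ℕ) = g by omega,
      show (m : ℤ) + (a₁ - m : ℕ) = a₁ by omega,
      show (m : ℤ) + (a₂ - m : ℕ) = a₂ by omega] at h'
    simp only [exceptC, exceptC6, Set.mem_union] at h' ⊢
    tauto

end Residual

end ExceptionalFamilies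

namespace unicyclicGraph

variable {g a₁ a₂ m r : ℕ} [NeZero g]

theorem isBurnable_of_coverable_hub (hg : 2 ≤ g)
    (h : Coverable m ![g - (2 * m + 1), a₁ - m, a₂ - m]) :
    IsBurnable (unicyclicGraph g a₁ a₂) (m + 1) :=
  isBurnable_of_coverable hg (Nat.zero_le m) (Nat.zero_le a₁) h

theorem isBurnable_of_longest (hg : 2 * (m + 1) ≤ g) (hn : g + a₁ + a₂ = (m + 1) ^ 2 + r)
    (h₁ : a₁ - m ≤ g - (2 * m + 1)) (h₂ : a₂ - m ≤ a₁ - m)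
    (hs : g - (2 * m + 1) + (a₁ - m) + (a₂ - m) ≤ m ^ 2)
    (hC : ((g : ℤ), (a₁ : ℤ), (a₂ : ℤ)) ∉ exceptC (m + 1) r) :
    IsBurnable (unicyclicGraph g a₁ a₂) (m + 1) := by
  by_cases hE : Exceptional m (g - (2 * m + 1)) (a₁ - m) (a₂ - m)
  · obtain ⟨hy, hz, hx⟩ := (mem_exceptC_of_longest hn h₁ h₂ hE).resolve_left hC
    have hm : 2 < m := lt_of_pow_lt_pow_left₀ 2 (Nat.zero_le m) (by omega)
    refine isBurnable_of_coverable (d := 1) (by omega) (by omega) (by omega) ?_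
    rw [show a₂ - (m - 1) = 3 by omega, show a₁ - (m + 1) = 1 by omega]
    refine (coverable_of_not_exceptional (z := 1) (y := 3) (by omega) (by omega) (by omega)
      ?_).swap_right
    simp [Exceptional, shortPathExceptions, sporadicExceptions]
  · exact isBurnable_of_coverable_hub (by omega) (coverable_of_not_exceptional h₂ h₁ hs hE)

theorem isBurnable_of_middle (hg : 2 * (m + 1) ≤ g) (hn : g + a₁ + a₂ = (m + 1) ^ 2 + r)
    (h₁ : g - (2 * m + 1) < a₁ - m) (h₂ : a₂ - m ≤ g - (2 * m + 1))
    (hs : g - (2 * m + 1) + (a₁ - m) + (a₂ - m) ≤ m ^ 2)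
    (hC : ((g : ℤ), (a₁ : ℤ), (a₂ : ℤ)) ∉ exceptC (m + 1) r) :
    IsBurnable (unicyclicGraph g a₁ a₂) (m + 1) := by
  by_cases hE : Exceptional m (a₁ - m) (g - (2 * m + 1)) (a₂ - m)
  · obtain ⟨hy, hz, hx⟩ := (mem_exceptC_of_middle hn h₁.le h₂ hE).resolve_left hC
    have hm : 3 < m := lt_of_pow_lt_pow_left₀ 2 (Nat.zero_le m) (by omega)
    have hm' : 4 ^ 2 ≤ m ^ 2 := Nat.pow_le_pow_left hm 2
    refine isBurnable_of_coverable (d := 1) (by omega) (by omega) (by omega) ?_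
    rw [show a₂ - (m - 1) = 3 by omega]
    refine (coverable_of_not_exceptional (z := 3) (by omega) (by omega) (by omega) ?_).swap_left
    rintro (h | ⟨s, h, h'⟩ | h)
    · omega
    · obtain ⟨rfl, hy'⟩ | ⟨rfl, hy'⟩ : s = 1 ∧ g - (2 * (m - 1) + 1) = 4 ∨
          s = 0 ∧ g - (2 * (m - 1) + 1) = 5 := by omega
      all_goals rw [hy'] at h'; revert h'; decide
    · obtain hy' | hy' : g - (2 * (m - 1) + 1) = 4 ∨ g - (2 * (m - 1) + 1) = 5 := by omega
      all_goals simp [hy', sporadicExceptions] at h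
  · exact isBurnable_of_coverable_hub (by omega)
      (coverable_of_not_exceptional h₂ h₁.le (by omega) hE).swap_left

theorem isBurnable_of_shortest (hg : 2 * (m + 1) ≤ g) (h₁ : a₂ - m ≤ a₁ - m)
    (h₂ : g - (2 * m + 1) < a₂ - m)
    (hs : g - (2 * m + 1) + (a₁ - m) + (a₂ - m) ≤ m ^ 2)
    (hC : ((g : ℤ), (a₁ : ℤ), (a₂ : ℤ)) ∉ exceptC (m + 1) r) :
    IsBurnable (unicyclicGraph g a₁ a₂) (m + 1) :=
  isBurnable_of_coverable_hub (by omega) <| Coverable.swap_left <| Coverable.swap_right <|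
    coverable_of_not_exceptional h₂.le h₁ (by omega) fun hE =>
      hC (mem_exceptC_of_shortest hg h₁ h₂ hE)

theorem isBurnable_of_long_cycle (ha : a₂ ≤ a₁) (hn : g + a₁ + a₂ = (m + 1) ^ 2 + r)
    (hr : r ≤ 2 * m) (hg : 2 * (m + 1) ≤ g) (hgm : g ≤ (m + 1) ^ 2) (ha₂ : r ≤ a₂ + m)
    (hC : ((g : ℤ), (a₁ : ℤ), (a₂ : ℤ)) ∉ exceptC (m + 1) r) :
    IsBurnable (unicyclicGraph g a₁ a₂) (m + 1) := by
  have hsq : (m + 1) ^ 2 = m ^ 2 + 2 * m + 1 := by ring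
  have hs : g - (2 * m + 1) + (a₁ - m) + (a₂ - m) ≤ m ^ 2 := by omega
  obtain h₁ | h₁ := le_or_gt (a₁ - m) (g - (2 * m + 1))
  · exact isBurnable_of_longest hg hn h₁ (by omega) hs hC
  obtain h₂ | h₂ := le_or_gt (a₂ - m) (g - (2 * m + 1))
  · exact isBurnable_of_middle hg hn h₁ h₂ hs hC
  · exact isBurnable_of_shortest hg (by omega) h₂ hs hC

theorem isBurnable_of_short_cycle_of_le (hg : 2 ≤ g) (ha : a₂ ≤ a₁)
    (hn : g + a₁ + a₂ = (m + 1) ^ 2 + r) (hrg : r + 1 ≤ g) (hgm : g ≤ 2 * m + 1) (hm : m ≤ a₂)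
    (hB : ((g : ℤ), (a₁ : ℤ), (a₂ : ℤ)) ∉ exceptB (m + 1)) :
    IsBurnable (unicyclicGraph g a₁ a₂) (m + 1) := by
  have hsq : (m + 1) ^ 2 = m ^ 2 + 2 * m + 1 := by ring
  have hsmall : m = 1 ∨ m = 2 ∨ 3 ≤ m ∧ 9 ≤ m ^ 2 := by
    obtain h | h := le_or_gt m 2
    · omega
    · exact .inr (.inr ⟨h, Nat.pow_le_pow_left h 2⟩)
  by_cases hE : a₁ - m + (a₂ - m) = m ^ 2 ∧ (a₁ - m = 2 ∨ a₂ - m = 2)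
  · obtain ⟨ha₁, ha₂⟩ : a₁ = m ^ 2 + m - 2 ∧ a₂ = m + 2 := by
      rcases hsmall with rfl | rfl | h <;> omega
    have hgm' : g + 1 ≤ 2 * m := by
      by_contra hcon
      refine hB ?_
      have hsq' : ((m : ℤ) + 1) ^ 2 = (m ^ 2 : ℕ) + 2 * m + 1 := by push_cast; ring
      simp only [exceptB, Set.mem_insert_iff, Set.mem_singleton_iff, Prod.mk.injEq, hsq']
      clear hsmall
      generalize m ^ 2 = M at *
      omega
    have hm5 : m ^ 2 ≠ 5 ∧ 4 ≤ m ^ 2 := by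
      rcases hsmall with rfl | rfl | h <;> omega
    refine isBurnable_of_coverable (d := 1) (by omega) (by omega) (by omega) ?_
    rw [show g - (2 * (m - 1) + 1) = 0 by omega]
    exact coverable_two_paths (by omega) (by omega)
  · refine isBurnable_of_coverable_hub (by omega) ?_
    rw [show g - (2 * m + 1) = 0 by omega]
    exact coverable_two_paths (by omega) hE

theorem isBurnable_of_short_cycle_of_lt (hg : 2 ≤ g)
    (hn : g + a₁ + a₂ = (m + 1) ^ 2 + r) (hrg : r + 1 ≤ g) (hgm : g ≤ 2 * m + 1)
    (ha₁ : a₁ + g / 2 + 1 ≤ (m + 1) ^ 2) (hm : a₂ < m) :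
    IsBurnable (unicyclicGraph g a₁ a₂) (m + 1) := by
  have hsq : (m + 1) ^ 2 = m ^ 2 + 2 * m + 1 := by ring
  have hm2 : m ^ 2 ≠ 2 := by
    obtain h | h := le_or_gt m 1
    · interval_cases m <;> norm_num
    · exact (Nat.pow_le_pow_left h 2).trans_lt' (by norm_num) |>.ne'
  obtain h₁ | h₁ := le_or_gt a₁ m
  · refine isBurnable_of_coverable_hub (by omega) ?_
    rw [show g - (2 * m + 1) = 0 by omega]
    exact coverable_two_paths (by omega) (by omega)
  -- The largest shift for which the ball still contains the cycle and the second path.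
  obtain ⟨d, hd⟩ : ∃ d, d = min (m - g / 2) (m - a₂) := ⟨_, rfl⟩
  refine isBurnable_of_coverable (d := d) hg (by omega) (by omega) ?_
  rw [show g - (2 * (m - d) + 1) = 0 by omega, show a₂ - (m - d) = 0 by omega]
  exact coverable_two_paths (by omega) (by omega)

end unicyclicGraph

theorem ceil_sqrt_sub_one {q r : ℕ} (hr : 1 ≤ r) (hrq : r ≤ 2 * q + 1) :
    ⌈√((q ^ 2 + r : ℕ) : ℝ)⌉ - 1 = (q : ℤ) := by
  rw [sub_eq_iff_eq_add, Int.ceil_eq_iff]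
  have h₁ : (1 : ℝ) ≤ r := by exact_mod_cast hr
  have h₂ : (r : ℝ) ≤ 2 * q + 1 := by exact_mod_cast hrq
  push_cast
  constructor
  · rw [add_sub_cancel_right]
    exact Real.lt_sqrt_of_sq_lt (by linarith)
  · exact Real.sqrt_le_iff.2 ⟨by positivity, by linarith⟩

theorem theorem4p3 (g a₁ a₂ n q r : ℕ) (hg : 3 ≤ g) (ha₂ : 1 ≤ a₂) (ha : a₂ ≤ a₁)
    (hn : n = Fintype.card (Fin g ⊕ Fin a₁ ⊕ Fin a₂)) (hnq : n = q ^ 2 + r)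
    (hr : 1 ≤ r) (hrq : (r : ℤ) ≤ 2 * q - 2)
    (h : (r + 1 ≤ g ∧ (g : ℤ) ≤ 2 * q - 1 ∧ (a₁ : ℤ) ≤ (q : ℤ) ^ 2 - (g : ℤ) / 2 - 1 ∧
            ((g : ℤ), (a₁ : ℤ), (a₂ : ℤ)) ∉ exceptB q) ∨
         (2 * q ≤ g ∧ g ≤ q ^ 2 ∧ (a₂ : ℤ) ≥ (r : ℤ) - q + 1 ∧
            ((g : ℤ), (a₁ : ℤ), (a₂ : ℤ)) ∉ exceptC q r)) :
    (burningNumber (unicyclicGraph g a₁ a₂) : ℤ) = ⌈Real.sqrt n⌉ - 1 ∧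
      ⌈Real.sqrt n⌉ - 1 = (q : ℤ) := by
  obtain ⟨m, rfl⟩ : ∃ m, q = m + 1 := ⟨q - 1, by omega⟩
  have hceil : ⌈√(n : ℝ)⌉ - 1 = ((m + 1 : ℕ) : ℤ) := hnq ▸ ceil_sqrt_sub_one hr (by omega)
  refine ⟨?_, hceil⟩
  rw [hceil, Nat.cast_inj]
  have : NeZero g := ⟨by omega⟩
  have hsum : g + a₁ + a₂ = (m + 1) ^ 2 + r := by simp at hn; omega
  have hburn : IsBurnable (unicyclicGraph g a₁ a₂) (m + 1) := by
    obtain ⟨hrg, hgm, ha₁, hB⟩ | ⟨hgm, hgq, har, hC⟩ := h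
    · have ha₁ : a₁ + g / 2 + 1 ≤ (m + 1) ^ 2 := by zify; push_cast at ha₁; linarith
      obtain hm | hm := le_or_gt m a₂
      · exact unicyclicGraph.isBurnable_of_short_cycle_of_le (by omega) ha hsum hrg (by omega) hm
          (by exact_mod_cast hB)
      · exact unicyclicGraph.isBurnable_of_short_cycle_of_lt (by omega) hsum hrg (by omega) ha₁ hm
    · exact unicyclicGraph.isBurnable_of_long_cycle ha hsum (by omega) hgm hgq (by omega)
        (by exact_mod_cast hC)
  exact le_antisymm (Nat.sInf_le hburn) <| le_csInf ⟨_, hburn⟩ fun k hk =>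
    unicyclicGraph.le_of_isBurnable (by omega) (by omega) hk
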